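/- Let $L$ be a context-free language over a finite alphabet $\mathrm{Lex}$. Then there is a restricted attribute-value grammar (R-AVG) $G$ with $L(G) = L\setminus\{\varepsilon\}$; that is, for every word $w$, $w\in L(G)$ if and only if $w\in L$ and $w\neq\varepsilon$. In particular $L(G)=L$ whenever $\varepsilon\notin L$. Here an R-AVG over $\mathrm{Lex}$ consists of finite sets of categories, constants and attributes, a start category, and a finite set of rules of one of the forms $c_0\to l_1\cdots l_i$ with a formula in the variable $x_0$, or $c_0\to l_1\cdots l_i\,c_1$ with a formula in the variables $x_0,x_1$, where $i\ge 1$, $l_1,\dots,l_i\in\mathrm{Lex}$ and $c_0,c_1$ are categories. A formula is a conjunction of one or more path equations $ps\doteq qt$, where $p,q$ are finite sequences of attributes and $s,t$ are variables or constants, a constant being allowed only with the empty sequence. A feature graph consists of a root, which is a variable or a constant, and a finite set of edges $(y,f,s)$ ($y$ a variable, $f$ an attribute, $s$ a variable or a constant) such that $(y,f,s)$ and $(y,f,t)$ being edges implies $s=t$, and every source $y$ of an edge is reachable from the root. Variables are taken from a countably infinite set. A set $F$ of formulas is consistent if there are a feature graph and an assignment of nodes of that graph to the variables (each constant denoting itself)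 under which every path equation $ps\doteq qt$ occurring in $F$ holds: the paths $p$ from $s$ and $q$ from $t$ exist and end in the same node. The language $L(G)$ is the set of words read off the leaves, from left to right, of the finite ordered trees $T$ whose leaves are labelled by elements of $\mathrm{Lex}$ and whose internal nodes $v$ are labelled by a category and a variable $h(v)$, such that the root is an internal node labelled by the start category and, for some consistent set $F$ of formulas, every internal node $v$ is licensed by a rule: either by $(c_0\to l_1\cdots l_i,\ \varphi)$, where $v$ has category $c_0$, its daughters are leaves $l_1,\dots,l_i$ and $\varphi[x_0/h(v)]\in F$; or by $(c_0\to l_1\cdots l_i\,c_1,\ \varphi)$, where $v$ has category $c_0$, its daughters are leaves $l_1,\dots,l_i$ followed by an internal node $v_1$ of category $c_1$, and $\varphi[x_0/h(v),x_1/h(v_1)]\in F$. -/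

import Mathlib

namespace AVG

/-! Attribute-value languages. `A` is the set of constants, `X` (or `V`) the set of variables and
`L` the set of attributes. A sequence of attributes is listed in the order in which it is
traversed, first attribute first. -/

/-- Terms: constants and variables. They are also the possible nodes of a feature graph. -/
inductive Term (A V : Type) : Type
  | const (a : A) : Term A V
  | var (x : V) : Term A V

/-- The two sides `p s` of path equations: a sequence `p` of attributes starting from a term `s`,
where `s` may be a constant only if `p` is empty. -/
inductive PathTerm (A X L : Type) : Type
  | const (a : A) : PathTerm A X L
  | path (p : List L) (x : X) : PathTerm A X L

/-- Formulas of the restricted attribute-value language: path equations and their conjunctions. -/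
inductive Formula (A X L : Type) : Type
  | eq (s t : PathTerm A X L) : Formula A X L
  | and (φ ψ : Formula A X L) : Formula A X L

/-- Substitution of variables for variables. -/
def PathTerm.subst {A X Y L : Type} (σ : X → Y) : PathTerm A X L → PathTerm A Y L
  | .const a => .const a
  | .path p x => .path p (σ x)

/-- Substitution of variables for variables. -/
def Formula.subst {A X Y L : Type} (σ : X → Y) : Formula A X L → Formula A Y L
  | .eq s t => .eq (s.subst σ) (t.subst σ)
  | .and φ ψ => .and (φ.subst σ) (ψ.subst σ)

/-- An edge leads from a variable, along an attribute, to a variable or a constant. -/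
structure Edge (A V L : Type) : Type where
  source : V
  attr : L
  target : Term A V

/-- `IsPath E s p t`: the edges in `E` contain a path from `s` to `t` with attributes `p`. -/
inductive IsPath {A V L : Type} (E : Set (Edge A V L)) : Term A V → List L → Term A V → Prop
  | nil (s : Term A V) : IsPath E s [] s
  | cons {x : V} {f : L} {s t : Term A V} {p : List L} :
      (⟨x, f, s⟩ : Edge A V L) ∈ E → IsPath E s p t → IsPath E (.var x) (f :: p) t

/-- Feature graphs: a root and a finite set of edges, deterministic and reachable from the root.
If the root is a constant, there are no edges (`FeatureGraph.edges_eq_empty`), so that this covers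
both the pairs `(a, ∅)` and the pairs `(x, E)`. -/
structure FeatureGraph (A V L : Type) : Type where
  root : Term A V
  edges : Set (Edge A V L)
  finite_edges : edges.Finite
  deterministic : ∀ (x : V) (f : L) (s t : Term A V),
    (⟨x, f, s⟩ : Edge A V L) ∈ edges → (⟨x, f, t⟩ : Edge A V L) ∈ edges → s = t
  reachable : ∀ e ∈ edges, ∃ p : List L, IsPath edges root p (.var e.source)

theorem FeatureGraph.edges_eq_empty {A V L : Type} (g : FeatureGraph A V L) (a : A)
    (h : g.root = .const a) : g.edges = ∅ := by
  refine Set.eq_empty_iff_forall_notMem.2 fun e he => ?_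
  obtain ⟨p, hp⟩ := g.reachable e he
  rw [h] at hp
  cases hp

/-- The nodes of a feature graph: the root and everything that can be reached from it. -/
def FeatureGraph.IsNode {A V L : Type} (g : FeatureGraph A V L) (s : Term A V) : Prop :=
  ∃ p : List L, IsPath g.edges g.root p s

/-- `g.Leads α s u`: if every variable `x` stands for the node `α x` (and constants for
themselves), the path `s` exists in `g` and ends in `u`. -/
def FeatureGraph.Leads {A V X L : Type} (g : FeatureGraph A V L) (α : X → Term A V) :
    PathTerm A X L → Term A V → Prop
  | .const a, u => IsPath g.edges (.const a) [] u
  | .path p x, u => IsPath g.edges (α x) p u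

/-- Satisfaction of a formula in a feature graph, the variable `x` standing for the node `α x`. -/
def FeatureGraph.Sat {A V X L : Type} (g : FeatureGraph A V L) (α : X → Term A V) :
    Formula A X L → Prop
  | .eq s t => ∃ u : Term A V, g.Leads α s u ∧ g.Leads α t u
  | .and φ ψ => g.Sat α φ ∧ g.Sat α ψ

/-- A set of formulas is consistent if it describes some feature graph: its variables can be
interpreted as nodes of that graph so that all the formulas hold. -/
def Consistent {A V L : Type} (F : Set (Formula A V L)) : Prop :=
  ∃ (g : FeatureGraph A V L) (α : V → Term A V),
    (∀ x, g.IsNode (α x)) ∧ ∀ φ ∈ F, g.Sat α φ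

/-- Ordered constituent structure trees together with the annotation `h`: a leaf carries a lexical
form, an internal node `v` a category, the variable `h v` and the list of its daughters. -/
inductive Tree (T C V : Type*) : Type _
  | leaf (l : T) : Tree T C V
  | node (c : C) (n : V) (daughters : List (Tree T C V)) : Tree T C V

/-- The word read off the leaves of a tree, from left to right. -/
def Tree.yield {T C V : Type*} : Tree T C V → List T
  | .leaf l => [l]
  | .node _ _ ds => ds.flatMap fun d => d.yield

/-- `IsSubtree s t`: `s` is the subtree of `t` at some node of `t`. -/
inductive IsSubtree {T C V : Type*} (s : Tree T C V) : Tree T C V → Prop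
  | refl : IsSubtree s s
  | daughter (c : C) (n : V) (ds : List (Tree T C V)) (t : Tree T C V) :
      t ∈ ds → IsSubtree s t → IsSubtree s (.node c n ds)

/-- Syntactic rules of a restricted attribute-value grammar: `c₀ → l₁ … lᵢ` with a formula in
`x₀`, or `c₀ → l₁ … lᵢ c₁` with a formula in `x₀, x₁`; in both cases `i ≥ 1`. -/
inductive Rule (T : Type*) (C A L : Type) : Type _
  | final (c₀ : C) (ls : List T) (hls : ls ≠ []) (φ : Formula A (Fin 1) L) : Rule T C A L
  | step (c₀ : C) (ls : List T) (hls : ls ≠ []) (c₁ : C) (φ : Formula A (Fin 2) L) : Rule T C A L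

/-- A rule licenses an internal node with category `c`, variable `n` and daughters `ds`, relative
to the set of formulas `F`. -/
def Rule.Licenses {T : Type*} {C A V L : Type} (F : Set (Formula A V L)) :
    Rule T C A L → C → V → List (Tree T C V) → Prop
  | .final c₀ ls _ φ, c, n, ds =>
      c = c₀ ∧ ds = ls.map Tree.leaf ∧ φ.subst ![n] ∈ F
  | .step c₀ ls _ c₁ φ, c, n, ds =>
      c = c₀ ∧ ∃ (n₁ : V) (ds₁ : List (Tree T C V)),
        ds = ls.map Tree.leaf ++ [Tree.node c₁ n₁ ds₁] ∧ φ.subst ![n, n₁] ∈ F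

/-- Restricted attribute-value grammars over the set `T` of lexical forms. -/
structure RAVG (T : Type*) where
  /-- categories -/
  Cat : Type
  /-- constants -/
  Const : Type
  /-- attributes -/
  Attr : Type
  finite_cat : Finite Cat
  finite_const : Finite Const
  finite_attr : Finite Attr
  rules : Finset (Rule T Cat Const Attr)
  start : Cat

/-- `G` generates the annotated tree `t` with the set `F` of formulas. The countable set of
variables is `ℕ`. -/
def RAVG.Generates {T : Type*} (G : RAVG T) (t : Tree T G.Cat ℕ)
    (F : Set (Formula G.Const ℕ G.Attr)) : Prop :=
  (∃ n ds, t = .node G.start n ds) ∧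
  (∀ c n ds, IsSubtree (.node c n ds) t → ∃ r ∈ G.rules, r.Licenses F c n ds) ∧
  Consistent F

/-- The language generated by `G`: the yields of the annotated trees that `G` generates. -/
def RAVG.language {T : Type*} (G : RAVG T) : Language T :=
  {w | ∃ t F, G.Generates t F ∧ t.yield = w}

end AVG

/-! By Greibach's theorem, `L` without the empty word is accepted by empty stack in a one-state
pushdown automaton that reads a letter per move and replaces the top symbol by at most two symbols.
An R-AVG tree is a right-branching chain, one node per move, and feature graphs supply the memory:
the variable of a node denotes a stack, and path equations relate consecutive stacks.

The Greibach form is obtained semantically: a "rule" is an inclusion between members of a finite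
family of languages, so no grammar is ever transformed. Splitting right-hand sides gives a binary
family (`isBinaryFamily_items`), and its left-corner languages turn it into a Greibach family
(`IsBinaryFamily.isGreibachFamily`).

For the grammar, `exists_isStack_of_licensed` recovers the stacks from any consistent tree, and
`exists_licensed_of_mem_listProd` builds a tree over a finite graph of all stacks of bounded height.
-/

namespace ContextFreeGrammar

/-! ### Derivations of words in a context-free grammar -/

variable {T : Type*}

/-- Big-step derivations: `g.Yields γ w` means that `g` derives the word `w` from `γ`. -/
inductive Yields (g : ContextFreeGrammar T) : List (Symbol T g.NT) → List T → Prop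
  | nil : Yields g [] []
  | terminal {a : T} {γ : List (Symbol T g.NT)} {w : List T} :
      Yields g γ w → Yields g (.terminal a :: γ) (a :: w)
  | nonterminal {r : ContextFreeRule T g.NT} {γ : List (Symbol T g.NT)} {u v : List T} :
      r ∈ g.rules → Yields g r.output u → Yields g γ v →
      Yields g (.nonterminal r.input :: γ) (u ++ v)

variable {g : ContextFreeGrammar T}

theorem Yields.append {γ δ : List (Symbol T g.NT)} {u v : List T}
    (hu : g.Yields γ u) (hv : g.Yields δ v) : g.Yields (γ ++ δ) (u ++ v) := by
  induction hu with
  | nil => exact hv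
  | terminal _ ih => exact .terminal ih
  | nonterminal hr ho _ _ ih =>
    rw [List.append_assoc]
    exact .nonterminal hr ho ih

theorem Yields.exists_of_append {γ δ : List (Symbol T g.NT)} {w : List T}
    (h : g.Yields (γ ++ δ) w) : ∃ u v, u ++ v = w ∧ g.Yields γ u ∧ g.Yields δ v := by
  induction γ generalizing w with
  | nil => exact ⟨[], w, rfl, .nil, h⟩
  | cons s γ ih =>
    cases h with
    | terminal h =>
      obtain ⟨u, v, rfl, hu, hv⟩ := ih h
      exact ⟨_, v, rfl, .terminal hu, hv⟩
    | nonterminal hr ho h =>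
      obtain ⟨u, v, rfl, hu, hv⟩ := ih h
      exact ⟨_, v, List.append_assoc .., .nonterminal hr ho hu, hv⟩

theorem yields_map_terminal (w : List T) : g.Yields (w.map .terminal) w := by
  induction w with
  | nil => exact .nil
  | cons a w ih => exact .terminal ih

/-- Cutting the word along context and right-hand side isolates the factor that the rewritten
nonterminal yields. -/
theorem Produces.yields {γ δ : List (Symbol T g.NT)} {w : List T} (h : g.Produces γ δ)
    (hw : g.Yields δ w) : g.Yields γ w := by
  obtain ⟨r, hr, h⟩ := h
  obtain ⟨p, q, rfl, rfl⟩ := h.exists_parts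
  obtain ⟨_, v, rfl, hu, hv⟩ := hw.exists_of_append
  obtain ⟨x, y, rfl, hx, hy⟩ := hu.exists_of_append
  refine (hx.append ?_).append hv
  simpa using Yields.nonterminal hr hy .nil

theorem Yields.derives {γ : List (Symbol T g.NT)} {w : List T} (h : g.Yields γ w) :
    g.Derives γ (w.map .terminal) := by
  induction h with
  | nil => exact Relation.ReflTransGen.refl
  | @terminal a γ w _ ih => exact Derives.append_left ih [.terminal a]
  | @nonterminal r γ u v hr _ _ ih₁ ih₂ =>
    rw [List.map_append]
    refine (Produces.single ⟨r, hr, .head γ⟩).trans ?_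
    exact (Derives.append_right ih₁ γ).trans (Derives.append_left ih₂ _)

theorem mem_language_iff_yields {w : List T} :
    w ∈ g.language ↔ g.Yields [.nonterminal g.initial] w := by
  refine ⟨fun h => ?_, fun h => h.derives⟩
  change g.Derives _ _ at h
  generalize [Symbol.nonterminal g.initial] = γ at h ⊢
  induction h using Relation.ReflTransGen.head_induction_on with
  | refl => exact yields_map_terminal w
  | head h _ ih => exact h.yields ih

end ContextFreeGrammar

/-! ### Binary families from context-free grammars -/

namespace Language

variable {T : Type*}

/-- A family of languages is binary if long words of its members split according to
concatenation rules that hold between members of the family. -/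
def IsBinaryFamily {Q : Type*} (L : Q → Language T) : Prop :=
  ∀ p, ∀ w ∈ L p, 2 ≤ w.length → ∃ q r, L q * L r ≤ L p ∧
    ∃ u ∈ L q, ∃ v ∈ L r, u ≠ [] ∧ v ≠ [] ∧ u ++ v = w

end Language

namespace ContextFreeGrammar

variable {T : Type*}

/-- The sentential forms that occur in binary splittings: the suffixes of right-hand sides, the
single symbols in right-hand sides, the initial symbol and the empty form. -/
def items (g : ContextFreeGrammar T) : Set (List (Symbol T g.NT)) :=
  {γ | γ = [] ∨ γ = [.nonterminal g.initial] ∨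
    ∃ r ∈ g.rules, γ <:+ r.output ∨ ∃ s ∈ r.output, γ = [s]}

variable {g : ContextFreeGrammar T}

theorem finite_items : g.items.Finite := by
  have h : g.items = {[]} ∪ ({[.nonterminal g.initial]} ∪
      ⋃ r ∈ (g.rules : Set (ContextFreeRule T g.NT)),
        ({γ | γ ∈ r.output.tails} ∪ (fun s => [s]) '' {s | s ∈ r.output})) := by
    ext γ
    simp only [items, Set.mem_ofPred_eq, Set.mem_union, Set.mem_singleton_iff, Set.mem_iUnion,
      List.mem_tails, Set.mem_image, Finset.mem_coe, exists_prop, eq_comm (a := γ) (b := [_])]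
  rw [h]
  refine (Set.finite_singleton _).union ((Set.finite_singleton _).union
    (g.rules.finite_toSet.biUnion fun r _ => ?_))
  exact (List.finite_toSet _).union ((List.finite_toSet _).image _)

theorem initial_mem_items : [.nonterminal g.initial] ∈ g.items := .inr (.inl rfl)

theorem tail_mem_items {s : Symbol T g.NT} {γ : List (Symbol T g.NT)} (h : s :: γ ∈ g.items) :
    γ ∈ g.items := by
  rcases h with h | h | ⟨r, hr, h | ⟨t, -, h⟩⟩
  · simp at h
  · simp only [List.cons.injEq] at h
    exact .inl h.2
  · exact .inr (.inr ⟨r, hr, .inl ((List.suffix_cons s γ).trans h)⟩)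
  · simp only [List.cons.injEq] at h
    exact .inl h.2

theorem head_mem_items {s : Symbol T g.NT} {γ : List (Symbol T g.NT)} (h : s :: γ ∈ g.items) :
    [s] ∈ g.items := by
  rcases h with h | h | ⟨r, hr, h | ⟨t, ht, h⟩⟩
  · simp at h
  · simp only [List.cons.injEq] at h
    exact .inr (.inl (by rw [h.1]))
  · exact .inr (.inr ⟨r, hr, .inr ⟨s, h.subset (by simp), rfl⟩⟩)
  · simp only [List.cons.injEq] at h
    exact .inr (.inr ⟨r, hr, .inr ⟨t, ht, by rw [h.1]⟩⟩)

/-- A form splits into its first symbol and the rest. If one of the two contributes the empty word,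
the splitting of the other is reused: its inclusion stays valid because the missing part can be
filled in with the empty word. Hence empty and unit productions need no elimination. -/
theorem isBinaryFamily_items :
    Language.IsBinaryFamily fun γ : g.items => ({w | g.Yields γ w} : Language T) := by
  rintro ⟨γ, hγ⟩ w hw hlen
  change g.Yields γ w at hw
  induction hw with
  | nil => simp at hlen
  | @terminal a γ w hw ih =>
    refine ⟨⟨_, head_mem_items hγ⟩, ⟨_, tail_mem_items hγ⟩, ?_, [a], .terminal .nil, w, hw,
      by simp, ?_, rfl⟩
    · rintro _ ⟨x, hx, y, hy, rfl⟩
      exact Yields.append hx hy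
    · rintro rfl
      simp at hlen
  | @nonterminal r γ u v hr ho hv ih₁ ih₂ =>
    have hr' : g.Yields [.nonterminal r.input] u := by simpa using Yields.nonterminal hr ho .nil
    rcases eq_or_ne u [] with rfl | hu
    · obtain ⟨p, q, hpq, h⟩ := ih₂ (tail_mem_items hγ) hlen
      exact ⟨p, q, fun x hx => Yields.append hr' (hpq hx), h⟩
    rcases eq_or_ne v [] with rfl | hv'
    · rw [List.append_nil] at hlen
      obtain ⟨p, q, hpq, h⟩ := ih₁ (.inr (.inr ⟨r, hr, .inl List.suffix_rfl⟩)) hlen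
      refine ⟨p, q, fun x hx => ?_, by simpa using h⟩
      simpa using Yields.nonterminal hr (hpq hx) hv
    · refine ⟨⟨_, head_mem_items hγ⟩, ⟨_, tail_mem_items hγ⟩, ?_, u, hr', v, hv, hu, hv', rfl⟩
      rintro _ ⟨x, hx, y, hy, rfl⟩
      exact Yields.append hx hy

end ContextFreeGrammar

namespace Language

variable {T : Type*}

theorem IsContextFree.exists_isBinaryFamily {L : Language T} (hL : L.IsContextFree) :
    ∃ (n : ℕ) (F : Fin n → Language T), IsBinaryFamily F ∧ ∃ i, F i = L := by
  obtain ⟨g, rfl⟩ := hL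
  have := g.finite_items.to_subtype
  obtain ⟨n, ⟨e⟩⟩ := Finite.exists_equiv_fin g.items
  refine ⟨n, fun i => {w | g.Yields (e.symm i) w}, ?_,
    e ⟨_, ContextFreeGrammar.initial_mem_items⟩, ?_⟩
  · intro i w hw hlen
    obtain ⟨q, r, h⟩ := ContextFreeGrammar.isBinaryFamily_items (e.symm i) w hw hlen
    exact ⟨e q, e r, by simpa only [Equiv.symm_apply_apply] using h⟩
  · ext w
    rw [ContextFreeGrammar.mem_language_iff_yields]
    change g.Yields (e.symm (e _)) w ↔ _
    rw [Equiv.symm_apply_apply]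

/-! ### Left corners and Greibach form -/

/-- `LeftCorner L p q` consists of the nonempty words that complete a word of `L q`, as a left
corner, to a word of `L p`. -/
inductive LeftCorner {Q : Type*} (L : Q → Language T) : Q → Q → List T → Prop
  | base {p q d : Q} {u : List T} : L q * L d ≤ L p → u ∈ L d → u ≠ [] → LeftCorner L p q u
  | step {p q d c : Q} {u v : List T} : L q * L d ≤ L c → u ∈ L d → u ≠ [] →
      LeftCorner L p c v → LeftCorner L p q (u ++ v)

variable {Q : Type*} {L : Q → Language T}

theorem LeftCorner.ne_nil {p q : Q} {w : List T} (h : LeftCorner L p q w) : w ≠ [] := by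
  cases h <;> simp_all

theorem LeftCorner.append_mem {p q : Q} {u w : List T} (h : LeftCorner L p q w) (hu : u ∈ L q) :
    u ++ w ∈ L p := by
  induction h generalizing u with
  | base hle hv _ => exact hle (append_mem_mul hu hv)
  | step hle hv _ _ ih =>
    rw [← List.append_assoc]
    exact ih (hle (append_mem_mul hu hv))

/-- The constructor `step` extends the left spine at its lower end; this extends it at the top. -/
theorem LeftCorner.append {p q r d : Q} {u v : List T} (h : LeftCorner L q r u)
    (hle : L q * L d ≤ L p) (hv : v ∈ L d) (hv' : v ≠ []) : LeftCorner L p r (u ++ v) := by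
  induction h with
  | base hle' hu hu' => exact .step hle' hu hu' (.base hle hv hv')
  | step hle' hu hu' _ ih =>
    rw [List.append_assoc]
    exact .step hle' hu hu' ih

/-- Following left factors of binary splittings shortens the word, so the descent ends at the single
letter `a`; the right factors met on the way make up `w`. -/
theorem IsBinaryFamily.exists_leftCorner (hL : IsBinaryFamily L) {p : Q} {a : T} {w : List T}
    (h : a :: w ∈ L p) (hw : w ≠ []) : ∃ e, [a] ∈ L e ∧ LeftCorner L p e w := by
  induction hn : w.length using Nat.strong_induction_on generalizing p w with
  | _ n ih =>
    subst hn
    obtain ⟨q, r, hle, u, hu, v, hv, hu', hv', huv⟩ := hL p _ h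
      (by simpa [Nat.one_le_iff_ne_zero] using hw)
    cases u with
    | nil => exact absurd rfl hu'
    | cons b u =>
      simp only [List.cons_append, List.cons.injEq] at huv
      obtain ⟨rfl, rfl⟩ := huv
      rcases eq_or_ne u [] with rfl | hne
      · exact ⟨q, hu, .base hle hv hv'⟩
      · obtain ⟨e, he, hlc⟩ := ih u.length
          (by simpa using List.length_pos_iff.2 hv') hu hne rfl
        exact ⟨e, he, hlc.append hle hv hv'⟩

/-- The words of a list of members of a family of languages. -/
def listProd {Γ : Type*} (F : Γ → Language T) (β : List Γ) : Language T := (β.map F).prod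

/-- A family of languages is in Greibach form if its members do not contain the empty word, and
after removal of the first letter their words split into at most two words of the family,
according to rules that hold for the family. -/
structure IsGreibachFamily {Γ : Type*} (F : Γ → Language T) : Prop where
  nil_notMem : ∀ γ, [] ∉ F γ
  exists_rule : ∀ γ a w, a :: w ∈ F γ → ∃ β : List Γ, β.length ≤ 2 ∧ w ∈ listProd F β ∧
    ∀ v ∈ listProd F β, a :: v ∈ F γ

/-- The members of a family, without the empty word, and their left-corner languages. -/
def greibachFamily (L : Q → Language T) : Q ⊕ Q × Q → Language T
  | .inl p => {w | w ∈ L p ∧ w ≠ []}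
  | .inr (p, q) => {w | LeftCorner L p q w}

theorem IsBinaryFamily.isGreibachFamily (hL : IsBinaryFamily L) :
    IsGreibachFamily (greibachFamily L) where
  nil_notMem := by
    rintro (p | ⟨p, q⟩) h
    · exact h.2 rfl
    · exact LeftCorner.ne_nil h rfl
  exists_rule := by
    -- After its first letter, a word of `L p` needs at most one left-corner symbol. A left-corner
    -- word begins with a word of some `L d`, so it needs at most that symbol and one more for the
    -- remaining spine: hence the bound two.
    have key (p : Q) (a : T) (w : List T) (h : a :: w ∈ L p) :
        ∃ β : List (Q ⊕ Q × Q), β.length ≤ 1 ∧ w ∈ listProd (greibachFamily L) β ∧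
          ∀ v ∈ listProd (greibachFamily L) β, a :: v ∈ L p := by
      rcases eq_or_ne w [] with rfl | hw
      · refine ⟨[], by simp, rfl, ?_⟩
        rintro v rfl
        exact h
      · obtain ⟨e, he, hlc⟩ := hL.exists_leftCorner h hw
        refine ⟨[.inr (p, e)], by simp, ?_, fun v hv => ?_⟩
        · rwa [listProd, List.map_singleton, List.prod_singleton]
        · rw [listProd, List.map_singleton, List.prod_singleton] at hv
          exact LeftCorner.append_mem hv he
    rintro (p | ⟨p, q⟩) a w h
    · obtain ⟨β, hβ, hw, hv⟩ := key p a w h.1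
      exact ⟨β, by omega, hw, fun v hv' => ⟨hv v hv', by simp⟩⟩
    · change LeftCorner L p q (a :: w) at h
      generalize hx : a :: w = x at h
      cases h with
      | base hle hu hu' =>
        subst hx
        obtain ⟨β, hβ, hw, hv⟩ := key _ a w hu
        exact ⟨β, by omega, hw, fun v hv' => .base hle (hv v hv') (by simp)⟩
      | @step _ d c u v hle hu hu' hlc =>
        cases u with
        | nil => exact absurd rfl hu'
        | cons b u =>
          simp only [List.cons_append, List.cons.injEq] at hx
          obtain ⟨rfl, rfl⟩ := hx
          obtain ⟨β, hβ, hw, hv⟩ := key _ a u hu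
          have hprod : listProd (greibachFamily L) (β ++ [.inr (p, c)]) =
              listProd (greibachFamily L) β * greibachFamily L (.inr (p, c)) := by
            simp [listProd]
          refine ⟨β ++ [.inr (p, c)], by simp; omega, ?_, ?_⟩
          · rw [hprod]
            exact append_mem_mul hw hlc
          · rw [hprod]
            rintro _ ⟨y, hy, z, hz, rfl⟩
            exact LeftCorner.step hle (hv y hy) (by simp) hz

theorem IsContextFree.exists_isGreibachFamily {L : Language T} (hL : L.IsContextFree) :
    ∃ (Γ : Type) (_ : Finite Γ) (F : Γ → Language T), IsGreibachFamily F ∧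
      ∃ s, ∀ w, w ∈ F s ↔ w ∈ L ∧ w ≠ [] := by
  obtain ⟨n, F, hF, i, rfl⟩ := hL.exists_isBinaryFamily
  exact ⟨_, inferInstance, greibachFamily F, hF.isGreibachFamily, .inl i, fun w => Iff.rfl⟩

end Language

/-! ### Paths and satisfaction in feature graphs -/

namespace AVG

section Graph

variable {A V X Y L : Type}

theorem PathTerm.leads_subst {g : FeatureGraph A V L} {α : Y → Term A V} {σ : X → Y}
    {s : PathTerm A X L} {u : Term A V} : g.Leads α (s.subst σ) u ↔ g.Leads (α ∘ σ) s u := by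
  cases s <;> rfl

theorem Formula.sat_subst {g : FeatureGraph A V L} {α : Y → Term A V} {σ : X → Y}
    {φ : Formula A X L} : g.Sat α (φ.subst σ) ↔ g.Sat (α ∘ σ) φ := by
  induction φ with
  | eq s t => simp only [Formula.subst, FeatureGraph.Sat, PathTerm.leads_subst]
  | and φ ψ ih₁ ih₂ => simp only [Formula.subst, FeatureGraph.Sat, ih₁, ih₂]

theorem IsPath.append {E : Set (Edge A V L)} {s t u : Term A V} {p q : List L}
    (h : IsPath E s p t) (h' : IsPath E t q u) : IsPath E s (p ++ q) u := by
  induction h with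
  | nil => exact h'
  | cons he _ ih => exact .cons he (ih h')

theorem IsPath.exists_of_append {E : Set (Edge A V L)} {s u : Term A V} {p q : List L}
    (h : IsPath E s (p ++ q) u) : ∃ t, IsPath E s p t ∧ IsPath E t q u := by
  induction p generalizing s with
  | nil => exact ⟨s, .nil s, h⟩
  | cons f p ih =>
    cases h with
    | cons he h =>
      obtain ⟨t, ht, ht'⟩ := ih h
      exact ⟨t, .cons he ht, ht'⟩

theorem FeatureGraph.isPath_unique (g : FeatureGraph A V L) {s t u : Term A V} {p : List L}
    (h : IsPath g.edges s p t) (h' : IsPath g.edges s p u) : t = u := by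
  induction h with
  | nil =>
    cases h'
    rfl
  | cons he _ ih =>
    cases h' with
    | cons he' h' =>
      obtain rfl := g.deterministic _ _ _ _ he he'
      exact ih h'

theorem FeatureGraph.leads_const {g : FeatureGraph A V L} {α : X → Term A V} {a : A}
    {u : Term A V} : g.Leads α (.const a) u ↔ u = .const a := by
  constructor
  · intro h
    cases h
    rfl
  · rintro rfl
    exact .nil _

theorem FeatureGraph.sat_path_eq_const {g : FeatureGraph A V L} {α : X → Term A V} {p : List L}
    {x : X} {a : A} :
    g.Sat α (.eq (.path p x) (.const a)) ↔ IsPath g.edges (α x) p (.const a) := by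
  simp only [Sat, leads_const, exists_eq_right]
  rfl

end Graph

/-! ### Stacks described by path equations -/

section Stack

variable {Γ : Type}

/-- Attributes for stacks: `top` leads to the topmost symbol, or to `none` from the empty stack,
`pop` to the stack below it, and `push γ` to the stack with the additional symbol `γ`. -/
inductive StackAttr (Γ : Type) : Type
  | top : StackAttr Γ
  | pop : StackAttr Γ
  | push (γ : Γ) : StackAttr Γ

instance [Finite Γ] : Finite (StackAttr Γ) := by
  refine Finite.of_surjective
    (fun x : Option (Option Γ) => x.elim .top fun y => y.elim .pop .push) fun f => ?_
  cases f with
  | top => exact ⟨none, rfl⟩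
  | pop => exact ⟨some none, rfl⟩
  | push γ => exact ⟨some (some γ), rfl⟩

/-- The node `u` represents the stack `σ`. -/
def IsStack {V : Type} (E : Set (Edge (Option Γ) V (StackAttr Γ))) :
    Term (Option Γ) V → List Γ → Prop
  | u, [] => IsPath E u [.top] (.const none)
  | u, γ :: σ => IsPath E u [.top] (.const (some γ)) ∧
      ∃ v, IsPath E u [.pop] v ∧ IsStack E v σ

/-- The variable `x` stands for the stack whose only symbol is `γ`. -/
def singletonFormula {X : Type} (x : X) (γ : Γ) : Formula (Option Γ) X (StackAttr Γ) :=
  .and (.eq (.path [.top] x) (.const (some γ))) (.eq (.path [.pop, .top] x) (.const none))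

/-- From the node at the end of the path `p` from `x₁`, the symbols `β` can be popped, and this
leads to the same stack as popping one symbol from `x₀`. -/
def popFormula (p : List (StackAttr Γ)) : List Γ → Formula (Option Γ) (Fin 2) (StackAttr Γ)
  | [] => .eq (.path [.pop] 0) (.path p 1)
  | γ :: β => .and (.eq (.path (p ++ [.top]) 1) (.const (some γ))) (popFormula (p ++ [.pop]) β)

/-- The stack `x₁` results from `x₀` by replacing the topmost symbol `γ` by `β`. -/
def replaceFormula (γ : Γ) (β : List Γ) : Formula (Option Γ) (Fin 2) (StackAttr Γ) :=
  .and (.eq (.path [.top] 0) (.const (some γ))) (popFormula [] β)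

variable {V X : Type} {g : FeatureGraph (Option Γ) V (StackAttr Γ)}

theorem sat_singletonFormula {α : X → Term (Option Γ) V} {x : X} {γ : Γ} :
    g.Sat α (singletonFormula x γ) ↔ IsStack g.edges (α x) [γ] := by
  simp only [singletonFormula, FeatureGraph.Sat.eq_2, FeatureGraph.sat_path_eq_const, IsStack]
  refine and_congr_right fun _ => ⟨fun h => ?_, ?_⟩
  · exact IsPath.exists_of_append (p := [StackAttr.pop]) h
  · rintro ⟨v, hv, hv'⟩
    exact hv.append hv'

theorem IsStack.unique {u : Term (Option Γ) V} {σ τ : List Γ} (h : IsStack g.edges u σ)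
    (h' : IsStack g.edges u τ) : σ = τ := by
  induction σ generalizing u τ with
  | nil =>
    cases τ with
    | nil => rfl
    | cons γ τ => simpa using g.isPath_unique h h'.1
  | cons γ σ ih =>
    cases τ with
    | nil => simpa using g.isPath_unique h.1 h'
    | cons γ' τ =>
      obtain ⟨h, v, hv, hσ⟩ := h
      obtain ⟨h', v', hv', hτ⟩ := h'
      obtain rfl := g.isPath_unique hv hv'
      have := g.isPath_unique h h'
      simp only [Term.const.injEq, Option.some.injEq] at this
      rw [this, ih hσ hτ]

/-- Information flows from `x₁` to `x₀`: once the stack of `x₁` is known, determinism forces its top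
symbols to be `β`, and the last equation identifies the remainder with the `pop` of `x₀`. -/
theorem exists_of_sat_popFormula {α : Fin 2 → Term (Option Γ) V} {p : List (StackAttr Γ)}
    {β σ : List Γ} {u : Term (Option Γ) V} (h : g.Sat α (popFormula p β))
    (hp : IsPath g.edges (α 1) p u) (hσ : IsStack g.edges u σ) :
    ∃ δ, σ = β ++ δ ∧ ∃ v, IsPath g.edges (α 0) [.pop] v ∧ IsStack g.edges v δ := by
  induction β generalizing p σ u with
  | nil =>
    obtain ⟨v, hv, hv'⟩ := h
    obtain rfl := g.isPath_unique hp hv'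
    exact ⟨σ, rfl, _, hv, hσ⟩
  | cons γ β ih =>
    obtain ⟨h₁, h₂⟩ := h
    rw [FeatureGraph.sat_path_eq_const] at h₁
    obtain ⟨u', hu', h₁⟩ := h₁.exists_of_append
    obtain rfl := g.isPath_unique hp hu'
    cases σ with
    | nil => simpa using g.isPath_unique h₁ hσ
    | cons γ' σ =>
      obtain ⟨h₃, v, hv, hσ⟩ := hσ
      obtain ⟨δ, rfl, h⟩ := ih h₂ (hp.append hv) hσ
      have := g.isPath_unique h₁ h₃
      simp only [Term.const.injEq, Option.some.injEq] at this
      exact ⟨δ, by rw [this]; rfl, h⟩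

theorem IsStack.of_sat_replaceFormula {α : Fin 2 → Term (Option Γ) V} {γ : Γ} {β σ : List Γ}
    (h : g.Sat α (replaceFormula γ β)) (hσ : IsStack g.edges (α 1) σ) :
    ∃ δ, σ = β ++ δ ∧ IsStack g.edges (α 0) (γ :: δ) := by
  obtain ⟨h₁, h₂⟩ := h
  rw [FeatureGraph.sat_path_eq_const] at h₁
  obtain ⟨δ, rfl, h⟩ := exists_of_sat_popFormula h₂ (.nil _) hσ
  exact ⟨δ, rfl, h₁, h⟩

end Stack

/-! ### The finite graph of stacks of bounded height -/

section StackGraph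

variable {Γ : Type} [Encodable Γ]

/-- The node of the stack graph for the stack `σ`. -/
def stackNode (σ : List Γ) : Term (Option Γ) ℕ := .var (Encodable.encode σ)

/-- The edges between stacks of height at most `K`. -/
inductive IsStackEdge (K : ℕ) : Edge (Option Γ) ℕ (StackAttr Γ) → Prop
  | top (σ : List Γ) : σ.length ≤ K →
      IsStackEdge K ⟨Encodable.encode σ, .top, .const σ.head?⟩
  | pop (γ : Γ) (σ : List Γ) : σ.length < K →
      IsStackEdge K ⟨Encodable.encode (γ :: σ), .pop, stackNode σ⟩
  | push (γ : Γ) (σ : List Γ) : σ.length < K →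
      IsStackEdge K ⟨Encodable.encode σ, .push γ, stackNode (γ :: σ)⟩

theorem finite_isStackEdge [Finite Γ] (K : ℕ) :
    {e : Edge (Option Γ) ℕ (StackAttr Γ) | IsStackEdge K e}.Finite := by
  have hK : {σ : List Γ | σ.length ≤ K}.Finite := List.finite_length_le Γ K
  have h₁ := hK.image fun σ =>
    (⟨Encodable.encode σ, .top, .const σ.head?⟩ : Edge (Option Γ) ℕ (StackAttr Γ))
  have h₂ := ((Set.finite_univ (α := Γ)).prod hK).image fun x =>
    (⟨Encodable.encode (x.1 :: x.2), .pop, stackNode x.2⟩ : Edge (Option Γ) ℕ (StackAttr Γ))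
  have h₃ := ((Set.finite_univ (α := Γ)).prod hK).image fun x =>
    (⟨Encodable.encode x.2, .push x.1, stackNode (x.1 :: x.2)⟩ : Edge (Option Γ) ℕ (StackAttr Γ))
  refine ((h₁.union h₂).union h₃).subset ?_
  rintro _ (⟨σ, hσ⟩ | ⟨γ, σ, hσ⟩ | ⟨γ, σ, hσ⟩)
  · exact .inl (.inl ⟨σ, hσ, rfl⟩)
  · exact .inl (.inr ⟨(γ, σ), ⟨trivial, hσ.le⟩, rfl⟩)
  · exact .inr ⟨(γ, σ), ⟨trivial, hσ.le⟩, rfl⟩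

/-- This is the only purpose of the `push` edges: no formula of the grammar mentions them, but every
source must be reachable from the root, the empty stack. -/
theorem exists_isPath_stackNode {K : ℕ} {σ : List Γ} (hσ : σ.length ≤ K) :
    ∃ p, IsPath {e | IsStackEdge K e} (stackNode ([] : List Γ)) p (stackNode σ) := by
  induction σ with
  | nil => exact ⟨[], .nil _⟩
  | cons γ σ ih =>
    obtain ⟨p, hp⟩ := ih (Nat.le_of_succ_le hσ)
    exact ⟨_, hp.append (.cons (.push γ σ hσ) (.nil _))⟩

/-- The feature graph whose nodes represent the stacks of height at most `K`. -/
def stackGraph (Γ : Type) [Encodable Γ] [Finite Γ] (K : ℕ) :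
    FeatureGraph (Option Γ) ℕ (StackAttr Γ) where
  root := stackNode []
  edges := {e | IsStackEdge K e}
  finite_edges := finite_isStackEdge K
  deterministic := by
    intro x f s t hs ht
    change IsStackEdge K _ at hs ht
    generalize he : (⟨x, f, s⟩ : Edge (Option Γ) ℕ (StackAttr Γ)) = e at hs
    generalize he' : (⟨x, f, t⟩ : Edge (Option Γ) ℕ (StackAttr Γ)) = e' at ht
    cases hs <;> cases ht <;> simp_all
  reachable := by
    rintro _ (⟨σ, hσ⟩ | ⟨γ, σ, hσ⟩ | ⟨γ, σ, hσ⟩)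
    · exact exists_isPath_stackNode hσ
    · exact exists_isPath_stackNode hσ
    · exact exists_isPath_stackNode hσ.le

open Classical in
/-- The assignment of the nodes of the stack graph to the variables that encode them. -/
noncomputable def stackAssignment (Γ : Type) [Encodable Γ] (K x : ℕ) : Term (Option Γ) ℕ :=
  if ∃ σ : List Γ, σ.length ≤ K ∧ Encodable.encode σ = x then .var x else stackNode []

theorem stackAssignment_encode {K : ℕ} {σ : List Γ} (hσ : σ.length ≤ K) :
    stackAssignment Γ K (Encodable.encode σ) = stackNode σ :=
  if_pos ⟨σ, hσ, rfl⟩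

variable [Finite Γ] {K : ℕ}

theorem isPath_top {σ : List Γ} (hσ : σ.length ≤ K) :
    IsPath (stackGraph Γ K).edges (stackNode σ) [.top] (.const σ.head?) :=
  .cons (.top σ hσ) (.nil _)

theorem isPath_pop {γ : Γ} {σ : List Γ} (hσ : (γ :: σ).length ≤ K) :
    IsPath (stackGraph Γ K).edges (stackNode (γ :: σ)) [.pop] (stackNode σ) :=
  .cons (.pop γ σ hσ) (.nil _)

theorem isStack_stackNode {σ : List Γ} (hσ : σ.length ≤ K) :
    IsStack (stackGraph Γ K).edges (stackNode σ) σ := by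
  induction σ with
  | nil => exact isPath_top hσ
  | cons γ σ ih => exact ⟨isPath_top hσ, _, isPath_pop hσ, ih (Nat.le_of_succ_le hσ)⟩

theorem sat_popFormula {α : Fin 2 → Term (Option Γ) ℕ} {γ : Γ} {β δ : List Γ}
    {p : List (StackAttr Γ)} (h₀ : α 0 = stackNode (γ :: δ))
    (hδ : (γ :: δ).length ≤ K) (hβ : (β ++ δ).length ≤ K)
    (hp : IsPath (stackGraph Γ K).edges (α 1) p (stackNode (β ++ δ))) :
    (stackGraph Γ K).Sat α (popFormula p β) := by
  induction β generalizing p with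
  | nil =>
    refine ⟨_, ?_, hp⟩
    change IsPath _ (α 0) _ _
    rw [h₀]
    exact isPath_pop hδ
  | cons γ' β ih =>
    exact ⟨FeatureGraph.sat_path_eq_const.2 (hp.append (isPath_top hβ)),
      ih (Nat.le_of_succ_le hβ) (hp.append (isPath_pop hβ))⟩

theorem sat_replaceFormula {α : Fin 2 → Term (Option Γ) ℕ} {γ : Γ} {β δ : List Γ}
    (h₀ : α 0 = stackNode (γ :: δ)) (h₁ : α 1 = stackNode (β ++ δ))
    (hδ : (γ :: δ).length ≤ K) (hβ : (β ++ δ).length ≤ K) :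
    (stackGraph Γ K).Sat α (replaceFormula γ β) := by
  refine ⟨FeatureGraph.sat_path_eq_const.2 ?_, sat_popFormula h₀ hδ hβ ?_⟩
  · rw [h₀]
    exact isPath_top hδ
  · rw [h₁]
    exact .nil _

/-- Consistency asks every variable to denote a node, so those encoding no stack of height at most
`K` default to the root. -/
theorem isNode_stackAssignment (x : ℕ) :
    (stackGraph Γ K).IsNode (stackAssignment Γ K x) := by
  unfold stackAssignment
  split_ifs with h
  · obtain ⟨σ, hσ, rfl⟩ := h
    exact exists_isPath_stackNode hσ
  · exact ⟨[], .nil _⟩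

end StackGraph

end AVG

/-! ### Products of members of a Greibach family -/

namespace Language

variable {T Γ : Type*} {F : Γ → Language T}

theorem listProd_cons (F : Γ → Language T) (γ : Γ) (β : List Γ) :
    listProd F (γ :: β) = F γ * listProd F β := by
  simp [listProd]

theorem listProd_append (F : Γ → Language T) (β δ : List Γ) :
    listProd F (β ++ δ) = listProd F β * listProd F δ := by
  simp [listProd]

/-- Each symbol accounts for at least one letter. Stack heights are thus bounded by the length of
the word, which is why a finite graph suffices. -/
theorem IsGreibachFamily.length_le (hF : IsGreibachFamily F) {β : List Γ} {w : List T}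
    (h : w ∈ listProd F β) : β.length ≤ w.length := by
  induction β generalizing w with
  | nil => exact Nat.zero_le _
  | cons γ β ih =>
    rw [listProd_cons] at h
    obtain ⟨u, hu, v, hv, rfl⟩ := h
    have : u.length ≠ 0 := by
      rw [Ne, List.length_eq_zero_iff]
      rintro rfl
      exact hF.nil_notMem γ hu
    have := ih hv
    simp only [List.length_cons, List.length_append]
    omega

end Language

/-! ### The grammar of a Greibach family and its language -/

namespace AVG

open Language

theorem Tree.yield_node_map_leaf {T C V : Type*} (c : C) (n : V) (ls : List T) :
    (Tree.node c n (ls.map Tree.leaf)).yield = ls := by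
  simp [Tree.yield, List.flatMap_map]

theorem Tree.yield_node_map_leaf_append {T C V : Type*} (c : C) (n : V) (ls : List T)
    (t : Tree T C V) :
    (Tree.node c n (ls.map Tree.leaf ++ [t])).yield = ls ++ t.yield := by
  simp [Tree.yield, List.flatMap_map]

theorem IsSubtree.eq_or_of_map_leaf_append {T C V : Type*} {c c' : C} {n n' : V} {ls : List T}
    {ds : List (Tree T C V)} {ts : List (Tree T C V)}
    (h : IsSubtree (.node c' n' ds) (.node c n (ls.map Tree.leaf ++ ts))) :
    (c' = c ∧ n' = n ∧ ds = ls.map Tree.leaf ++ ts) ∨ ∃ t ∈ ts, IsSubtree (.node c' n' ds) t := by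
  cases h with
  | refl => exact .inl ⟨rfl, rfl, rfl⟩
  | daughter _ _ _ t ht h =>
    rw [List.mem_append, List.mem_map] at ht
    rcases ht with ⟨l, -, rfl⟩ | ht
    · cases h
    · exact .inr ⟨t, ht, h⟩

section Grammar

variable {T : Type*} {Γ : Type}

/-- In the start category (`true`), the stack `x` consists of the single symbol `s`. -/
def guardFormula {X : Type} (s : Γ) (b : Bool) (x : X) (φ : Formula (Option Γ) X (StackAttr Γ)) :
    Formula (Option Γ) X (StackAttr Γ) :=
  if b then .and φ (singletonFormula x s) else φ

theorem sat_guardFormula {V X : Type} {g : FeatureGraph (Option Γ) V (StackAttr Γ)}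
    {α : X → Term (Option Γ) V} {s : Γ} {b : Bool} {x : X}
    {φ : Formula (Option Γ) X (StackAttr Γ)} :
    g.Sat α (guardFormula s b x φ) ↔
      g.Sat α φ ∧ (b = true → IsStack g.edges (α x) [s]) := by
  cases b
  · simp [guardFormula]
  · simp [guardFormula, FeatureGraph.Sat, ← sat_singletonFormula]

/-- The rules of the grammar that reads one letter at a time and replaces the topmost symbol of a
stack by at most two symbols, according to the rules that hold for the family `F`. -/
inductive IsStackRule (F : Γ → Language T) (s : Γ) : Rule T Bool (Option Γ) (StackAttr Γ) → Prop
  | final (b : Bool) (γ : Γ) (a : T) : [a] ∈ F γ →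
      IsStackRule F s (.final b [a] (List.cons_ne_nil a [])
        (guardFormula s b 0 (singletonFormula 0 γ)))
  | step (b : Bool) (γ : Γ) (a : T) (β : List Γ) : β.length ≤ 2 →
      (∀ v ∈ listProd F β, a :: v ∈ F γ) →
      IsStackRule F s (.step b [a] (List.cons_ne_nil a []) false
        (guardFormula s b 0 (replaceFormula γ β)))

theorem finite_isStackRule [Finite T] [Finite Γ] (F : Γ → Language T) (s : Γ) :
    {r | IsStackRule F s r}.Finite := by
  have h₁ := (Set.finite_univ (α := Bool × Γ × T)).image fun x =>
    (Rule.final x.1 [x.2.2] (List.cons_ne_nil _ []) (guardFormula s x.1 0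
      (singletonFormula 0 x.2.1)) : Rule T Bool (Option Γ) (StackAttr Γ))
  have h₂ := ((Set.finite_univ (α := Bool × Γ × T)).prod (List.finite_length_le Γ 2)).image
    fun x => (Rule.step x.1.1 [x.1.2.2] (List.cons_ne_nil _ []) false (guardFormula s x.1.1 0
      (replaceFormula x.1.2.1 x.2)) : Rule T Bool (Option Γ) (StackAttr Γ))
  refine (h₁.union h₂).subset ?_
  rintro _ (⟨b, γ, a, -⟩ | ⟨b, γ, a, β, hβ, -⟩)
  · exact .inl ⟨(b, γ, a), trivial, rfl⟩
  · exact .inr ⟨((b, γ, a), β), ⟨trivial, hβ⟩, rfl⟩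

/-- The restricted attribute-value grammar of a Greibach family, with start symbol `s`. -/
noncomputable def stackGrammar [Finite T] [Finite Γ] (F : Γ → Language T) (s : Γ) : RAVG T where
  Cat := Bool
  Const := Option Γ
  Attr := StackAttr Γ
  finite_cat := inferInstance
  finite_const := inferInstance
  finite_attr := inferInstance
  rules := (finite_isStackRule F s).toFinset
  start := true

/-- Soundness, for an arbitrary graph. The final rule fixes the stack at the bottom of the chain,
and the replacement formulas carry this knowledge upwards. In the start category the guard, with
`IsStack.unique`, forces the stack `[s]`. -/
theorem exists_isStack_of_licensed {F : Γ → Language T} {s : Γ} {V : Type}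
    {g : FeatureGraph (Option Γ) V (StackAttr Γ)} {α : V → Term (Option Γ) V}
    {Φ : Set (Formula (Option Γ) V (StackAttr Γ))} (hΦ : ∀ φ ∈ Φ, g.Sat α φ)
    {c : Bool} {n : V} {ds : List (Tree T Bool V)}
    (h : ∀ c' n' ds', IsSubtree (.node c' n' ds') (.node c n ds) →
      ∃ r, IsStackRule F s r ∧ r.Licenses Φ c' n' ds') :
    ∃ σ, IsStack g.edges (α n) σ ∧ (Tree.node c n ds).yield ∈ listProd F σ ∧
      (c = true → σ = [s]) := by
  induction hN : (Tree.node c n ds).yield.length using Nat.strong_induction_on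
    generalizing c n ds with
  | _ N ih =>
    subst hN
    obtain ⟨_, ⟨b, γ, a, ha⟩ | ⟨b, γ, a, β, hβ, ha⟩, hlic⟩ := h c n ds .refl
    · obtain ⟨rfl, rfl, hφ⟩ := hlic
      obtain ⟨h₁, h₂⟩ := sat_guardFormula.1 (Formula.sat_subst.1 (hΦ _ hφ))
      rw [sat_singletonFormula] at h₁
      refine ⟨[γ], h₁, ?_, fun hc => h₁.unique (h₂ hc)⟩
      rw [Tree.yield_node_map_leaf, listProd, List.map_singleton, List.prod_singleton]
      exact ha
    · obtain ⟨rfl, n₁, ds₁, rfl, hφ⟩ := hlic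
      obtain ⟨h₁, h₂⟩ := sat_guardFormula.1 (Formula.sat_subst.1 (hΦ _ hφ))
      rw [Tree.yield_node_map_leaf_append] at ih ⊢
      obtain ⟨σ, hσ, hy, -⟩ := ih _ (by simp) (c := false) (n := n₁) (ds := ds₁)
        (fun c' n' ds' h' => h c' n' ds' (.daughter _ _ _ _ (by simp) h')) rfl
      obtain ⟨δ, rfl, hδ⟩ := IsStack.of_sat_replaceFormula h₁ hσ
      refine ⟨γ :: δ, hδ, ?_, fun hc => hδ.unique (h₂ hc)⟩
      rw [listProd_append] at hy
      obtain ⟨u, hu, v, hv, huv⟩ := hy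
      rw [listProd_cons, ← huv, ← List.append_assoc]
      exact append_mem_mul (ha u hu) hv

/-- Completeness: each node carries the code of its current stack, and the set of formulas is
everything true in the stack graph, so licensing reduces to satisfaction there. -/
theorem exists_licensed_of_mem_listProd [Encodable Γ] [Finite Γ] {F : Γ → Language T}
    (hF : IsGreibachFamily F) (s : Γ) {K : ℕ} {w : List T} (hw : w.length ≤ K) {σ : List Γ}
    (hσ : σ ≠ []) (h : w ∈ listProd F σ) {c : Bool} (hc : c = true → σ = [s]) :
    ∃ ds : List (Tree T Bool ℕ), (Tree.node c (Encodable.encode σ) ds).yield = w ∧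
      ∀ c' n' ds', IsSubtree (.node c' n' ds') (.node c (Encodable.encode σ) ds) →
        ∃ r, IsStackRule F s r ∧
          r.Licenses {φ | (stackGraph Γ K).Sat (stackAssignment Γ K) φ} c' n' ds' := by
  induction w generalizing σ c with
  | nil =>
    have := hF.length_le h
    exact absurd (List.length_eq_zero_iff.1 (Nat.le_zero.1 this)) hσ
  | cons a w ih =>
    have hK := (hF.length_le h).trans hw
    have hguard : c = true → IsStack (stackGraph Γ K).edges
        (stackAssignment Γ K (Encodable.encode σ)) [s] := by
      intro hc'
      obtain rfl := hc hc'
      rw [stackAssignment_encode hK]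
      exact isStack_stackNode hK
    cases σ with
    | nil => exact absurd rfl hσ
    | cons γ δ =>
      rw [listProd_cons] at h
      obtain ⟨u, hu, v, hv, huv⟩ := h
      cases u with
      | nil => exact absurd hu (hF.nil_notMem γ)
      | cons b u =>
        simp only [List.cons_append, List.cons.injEq] at huv
        obtain ⟨rfl, rfl⟩ := huv
        obtain ⟨β, hβ, hu', hrule⟩ := hF.exists_rule γ b u hu
        have hmem : u ++ v ∈ listProd F (β ++ δ) := by
          rw [listProd_append]
          exact append_mem_mul hu' hv
        have hlen : (u ++ v).length ≤ K := Nat.le_of_succ_le hw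
        have hK' := (hF.length_le hmem).trans hlen
        -- An empty new stack means that no input is left, so the final rule applies; otherwise the
        -- chain continues.
        rcases eq_or_ne (β ++ δ) [] with hnil | hne
        · rw [List.append_eq_nil_iff] at hnil
          obtain ⟨rfl, rfl⟩ := hnil
          obtain rfl : u = [] := hu'
          obtain rfl : v = [] := hv
          refine ⟨[b].map Tree.leaf, Tree.yield_node_map_leaf _ _ _, fun c' n' ds' h' => ?_⟩
          rw [← List.append_nil ([b].map Tree.leaf)] at h'
          replace h' := h'.eq_or_of_map_leaf_append
          obtain ⟨rfl, rfl, rfl⟩ | ⟨_, ht, -⟩ := h'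
          · refine ⟨_, .final c' γ b hu, rfl, by simp, ?_⟩
            refine Formula.sat_subst.2 (sat_guardFormula.2 ⟨sat_singletonFormula.2 ?_, hguard⟩)
            change IsStack _ (stackAssignment Γ K (Encodable.encode [γ])) _
            rw [stackAssignment_encode hK]
            exact isStack_stackNode hK
          · simp at ht
        -- Below the root the category is `false`, so the guard imposes nothing on the new stack.
        · obtain ⟨ds, hy, hds⟩ := ih hlen hne hmem (c := false) (by simp)
          refine ⟨[b].map Tree.leaf ++ [.node false (Encodable.encode (β ++ δ)) ds], ?_,
            fun c' n' ds' h' => ?_⟩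
          · rw [Tree.yield_node_map_leaf_append, hy]
            rfl
          · obtain ⟨rfl, rfl, rfl⟩ | ⟨t, ht, h'⟩ := h'.eq_or_of_map_leaf_append
            · refine ⟨_, .step c' γ b β hβ hrule, rfl, _, ds, rfl, ?_⟩
              refine Formula.sat_subst.2 (sat_guardFormula.2 ⟨?_, hguard⟩)
              exact sat_replaceFormula (stackAssignment_encode hK) (stackAssignment_encode hK')
                hK hK'
            · rw [List.mem_singleton] at ht
              subst ht
              exact hds c' n' ds' h'

theorem mem_language_stackGrammar [Finite T] [Finite Γ] {F : Γ → Language T}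
    (hF : IsGreibachFamily F) (s : Γ) (w : List T) :
    w ∈ (stackGrammar F s).language ↔ w ∈ F s := by
  have hlist (w : List T) : w ∈ listProd F [s] ↔ w ∈ F s := by
    rw [listProd, List.map_singleton, List.prod_singleton]
  constructor
  · rintro ⟨t, Φ, ⟨⟨n, ds, rfl⟩, hlic, g, α, -, hΦ⟩, rfl⟩
    obtain ⟨σ, -, hy, hs⟩ := exists_isStack_of_licensed (F := F) (s := s) hΦ
      fun c' n' ds' h => by
        obtain ⟨r, hr, h⟩ := hlic c' n' ds' h
        exact ⟨r, (Set.Finite.mem_toFinset _).1 hr, h⟩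
    rw [hs rfl] at hy
    exact (hlist _).1 hy
  · intro h
    obtain ⟨_⟩ := nonempty_encodable Γ
    -- The height bound `K` is taken to be the length of `w`.
    obtain ⟨ds, hy, hds⟩ := exists_licensed_of_mem_listProd hF s le_rfl
      (List.cons_ne_nil s []) ((hlist w).2 h) (c := true) fun _ => rfl
    refine ⟨_, _, ⟨⟨_, ds, rfl⟩, fun c' n' ds' h => ?_, stackGraph Γ w.length,
      stackAssignment Γ w.length, isNode_stackAssignment, fun _ hφ => hφ⟩, hy⟩
    obtain ⟨r, hr, h⟩ := hds c' n' ds' h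
    exact ⟨r, (Set.Finite.mem_toFinset _).2 hr, h⟩

end Grammar

end AVG

theorem mainTheorem2 {T : Type*} [Finite T] (L : Language T) (hL : L.IsContextFree) :
    ∃ G : AVG.RAVG T, ∀ w : List T, w ∈ G.language ↔ w ∈ L ∧ w ≠ [] := by
  obtain ⟨Γ, _, F, hF, s, hs⟩ := hL.exists_isGreibachFamily
  exact ⟨AVG.stackGrammar F s, fun w => (AVG.mem_language_stackGrammar hF s w).trans (hs w)⟩
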